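/- For probability measures $P,Q$ on $\mathbb R$ let $d_W(P,Q)=\sup_h|\int h\,dP-\int h\,dQ|$, the supremum over all $h:\mathbb R\to\mathbb R$ with Lipschitz constant at most $1$, and $d_K(P,Q)=\sup_{z\in\mathbb R}|P((-\infty,z])-Q((-\infty,z])|$. For a non-negative random variable $X$ with finite mean, $X^e$ has the equilibrium distribution with respect to $X$ if $\mathbb E f(X)-f(0)=\mathbb E X\,\mathbb E f'(X^e)$ for all Lipschitz $f$. For a distribution function $F$ let $F^{-1}(u)=\inf\{x: F(x)\ge u\}$, $0<u<1$. Let $X=(X_1,X_2,\dots)$ be a sequence of square integrable, non-negative random variables such that, for all $i\ge1$, $\mathbb E(X_i\mid X_1,\dots,X_{i-1})=\mu_i$ almost surely, where $\mu_i<\infty$ is a constant. Let $N$ be a positive integer valued random variable with $\mathbb E N<\infty$, suppose that $\mu:=\mathbb E\sum_{i=1}^N X_i$ satisfies $0<\mu<\infty$, and let $M$ be a random variable on the same probability space with $$P(M=m)=\mu_m P(N\ge m)/\mu,\qquad m=1,2,\dots.$$ For each $i\ge 1$ let $X_i^e$ be a random variable whose conditional law given $X_1,\dots,X_{i-1}$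 is the equilibrium distribution with respect to the conditional law of $X_i$ given $X_1,\dots,X_{i-1}$. Assume that, for each $i$, $(X,X_i^e)$ is independent of $(N,M)$. Let $W=\mu^{-1}\sum_{i=1}^N X_i$. Then $\mu=\sum_{m\ge1}\mu_mP(N\ge m)$ and $$d_W(\mathcal L(W),\mathrm{Exp}(1))\le 2\mu^{-1}\Bigl(\mathbb E|X_M-X_M^e|+\sup_{i\ge1}\mu_i\;\mathbb E|N-M|\Bigr),$$ where the right-hand side may be infinite and $\infty\cdot0=0$. Let moreover $F_{X_i}$ and $F_{X_i^e}$ be the conditional distribution functions of $X_i$ and of $X_i^e$ given $X_1,\dots,X_{i-1}$ (the ordinary distribution functions if the $X_i$ are independent and each $X_i^e$ is independent of $X_1,\dots,X_{i-1}$), and let $\|F_{X_i}^{-1}-F_{X_i^e}^{-1}\|$ be the supremum over $0<u<1$ and the essential supremum over $(X_1,\dots,X_{i-1})$ of $|F_{X_i}^{-1}(u)-F_{X_i^e}^{-1}(u)|$. If $X_i\le C$ almost surely for all $i$ and $|N-M|\le K$ almost surely, then $$d_K(\mathcal L(W),\mathrm{Exp}(1))\le 12\mu^{-1}\Bigl(\sup_{i\ge1}\|F_{X_i}^{-1}-F_{X_i^e}^{-1}\|+CK\Bigr).$$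 If $K=0$, that is, if $N=M$ almost surely, then $d_K(\mathcal L(W),\mathrm{Exp}(1))\le 12\mu^{-1}\sup_{i\ge1}\|F_{X_i}^{-1}-F_{X_i^e}^{-1}\|$ holds also for unbounded $X_i$. -/

import Mathlib

open MeasureTheory ProbabilityTheory
open scoped ENNReal

noncomputable section

namespace RandomSum

/-- The distance between two measures on `ℝ` induced by a set `F` of test functions,
`sup_{f ∈ F} |∫ f dP - ∫ f dQ|`, with values in `[0, ∞]`. -/
def testDist (F : Set (ℝ → ℝ)) (P Q : Measure ℝ) : ℝ≥0∞ :=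
  ⨆ f ∈ F, ENNReal.ofReal |(∫ x, f x ∂P) - ∫ x, f x ∂Q|

/-- Indicators of the half-lines `(-∞, z]`. -/
def kolmogorovTests : Set (ℝ → ℝ) :=
  {f | ∃ z : ℝ, f = (Set.Iic z).indicator (fun _ => (1 : ℝ))}

/-- Lipschitz functions with Lipschitz constant at most `1`. -/
def wassersteinTests : Set (ℝ → ℝ) := {f | LipschitzWith 1 f}

/-- The Kolmogorov distance. -/
def dK (P Q : Measure ℝ) : ℝ≥0∞ := testDist kolmogorovTests P Q

/-- The Wasserstein distance. -/
def dW (P Q : Measure ℝ) : ℝ≥0∞ := testDist wassersteinTests P Q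

/-- The law `νe` has the equilibrium distribution with respect to the law `ν` (on `[0, ∞)`, with
finite mean): `E f(X) - f(0) = E X * E f'(Xe)` for all Lipschitz `f`, where `X ∼ ν`, `Xe ∼ νe`.
If `E X > 0` then `νe` is absolutely continuous, so the null set on which `f` is not
differentiable (and `deriv f` is `0`) plays no role. -/
def IsEquilibrium (ν νe : Measure ℝ) : Prop :=
  ∀ f : ℝ → ℝ, (∃ L, LipschitzWith L f) →
    (∫ x, f x ∂ν) - f 0 = (∫ x, x ∂ν) * ∫ x, deriv f x ∂νe

/-- The generalized inverse `u ↦ inf {x | F(x) ≥ u}`, `0 < u < 1`, of the distribution function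
`F` of a probability measure on `ℝ`. -/
def quantile (ν : Measure ℝ) (u : ℝ) : ℝ := sInf {x : ℝ | u ≤ cdf ν x}

/-- The supremum norm (over `0 < u < 1`) of the difference of two quantile functions. -/
def quantileDist (ν ν' : Measure ℝ) : ℝ≥0∞ :=
  ⨆ u ∈ Set.Ioo (0 : ℝ) 1, ENNReal.ofReal |quantile ν u - quantile ν' u|

variable {Ω : Type*}

/-- The vector `(X 1, ..., X (i - 1))`. -/
def past (X : ℕ → Ω → ℝ) (i : ℕ) (ω : Ω) : Finset.Ico 1 i → ℝ := fun j => X j ω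

/-- The (regular) conditional law of `Y` given `X 1, ..., X (i - 1)`. -/
def condLaw [MeasurableSpace Ω] (P : Measure Ω) [IsFiniteMeasure P] (X : ℕ → Ω → ℝ) (i : ℕ)
    (Y : Ω → ℝ) (ω : Ω) : Measure ℝ :=
  condDistrib Y (past X i) P (past X i ω)

/-- The random sum `X 1 + ... + X N`. -/
def randomSum (X : ℕ → Ω → ℝ) (N : Ω → ℕ) (ω : Ω) : ℝ := ∑ i ∈ Finset.Icc 1 (N ω), X i ω

/-- `sup_{i ≥ 1} ‖F_i⁻¹ - G_i⁻¹‖`, where `F_i` and `G_i` are the conditional distribution functions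
of `X i` and of `Xe i` given `X 1, ..., X (i - 1)`; the norm is the essential supremum over the
conditioning variables. -/
def supQuantileDist [MeasurableSpace Ω] (P : Measure Ω) [IsFiniteMeasure P]
    (X Xe : ℕ → Ω → ℝ) : ℝ≥0∞ :=
  ⨆ i ≥ 1, essSup (fun ω => quantileDist (condLaw P X i (X i) ω) (condLaw P X i (Xe i) ω)) P

end RandomSum

end

/-! Write `S n` for the partial sums. Telescoping `f (S N) - f 0` over `n < N`, using independence
from `N`, and applying the conditional equilibrium identity to each increment gives `E f(S N) - f 0
= Σ μ_{n+1} P(N ≥ n+1) E f'(S n + Xe (n+1))`. The means `μ_{n+1}` are constants, so they leave the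
expectation, and the weights are `μ P(M = n+1)`. Thus `S (M-1) + Xe M` has the equilibrium
distribution of `S N` (`IsModel.hasSum_equilibrium`). Since `Exp(1)` is the fixed point of the
equilibrium transform, closeness of `W` to `We = μ⁻¹ (S (M-1) + Xe M)` forces closeness of `W` to
`Exp(1)`.

Wasserstein distance: the solution `f` of `f' = f + h - E h(Z)` is 1-Lipschitz, so `f'` is
2-Lipschitz, and `E h(W) - E h(Z) = E f'(W) - E f(W) = E f'(W) - E f'(We)` is at most `2 E|W - We|`.
Moreover `μ (W - We) = (X M - Xe M) + (S N - S M)`, and the mean of the last term is controlled by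
`lintegral_abs_partialSum_sub_le`.

Kolmogorov distance: no coupling of `X i` with `Xe i` is used, only their laws. The test function
`min x t` turns the equilibrium identity into a formula for the distribution function of `We`. Close
conditional quantile functions shift distribution functions by at most `δ`, so the tail `G` of `W`
and its integrated tail `H`, the tail of `We`, agree up to a shift `β`. As `H' = -G`, this is an
approximate version of `H' = -H`, and a Gronwall argument gives `|G x - exp (-x)| ≤ 2 β`
(`abs_tail_sub_exp_le`). -/

namespace RandomSum

open Filter Topology

/-! ### Gronwall comparison with the exponential tail; the Stein equation for `Exp(1)` -/

section Analysis

/-- Gronwall's inequality for `H' ≤ -c H` in finite-difference form, so that `H` need not be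
differentiable: iterate over `n` steps of length `x / n` and let `n → ∞`. -/
lemma le_exp_of_step {H : ℝ → ℝ} {c : ℝ} (hc : 0 ≤ c) (h0 : H 0 ≤ 1)
    (h : ∀ z w, 0 ≤ z → z ≤ w → H w * (1 + c * (w - z)) ≤ H z) {x : ℝ} (hx : 0 ≤ x) :
    H x ≤ Real.exp (-(c * x)) := by
  have key : ∀ n : ℕ, ∀ k : ℕ, H (k * (x / n)) * (1 + c * (x / n)) ^ k ≤ 1 := by
    intro n k
    have hd : 0 ≤ x / n := by positivity
    induction k with
    | zero => simpa using h0
    | succ k ih =>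
      refine le_trans ?_ ih
      have := h (k * (x / n)) ((k + 1 : ℕ) * (x / n)) (by positivity) (by gcongr; simp)
      rw [show ((k + 1 : ℕ) : ℝ) * (x / n) - k * (x / n) = x / n by push_cast; ring] at this
      rw [pow_succ', ← mul_assoc]
      exact mul_le_mul_of_nonneg_right this (by positivity)
  have hlim : Tendsto (fun n : ℕ => H x * (1 + (c * x) / n) ^ n) atTop
      (𝓝 (H x * Real.exp (c * x))) := (Real.tendsto_one_add_div_pow_exp (c * x)).const_mul _
  have hle : H x * Real.exp (c * x) ≤ 1 := by
    refine le_of_tendsto hlim ?_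
    filter_upwards [eventually_gt_atTop 0] with n hn
    have := key n n
    have hn' : (n : ℝ) ≠ 0 := by positivity
    rw [mul_div_cancel₀ _ hn', ← mul_div_assoc] at this
    exact this
  rw [Real.exp_neg, ← one_div, le_div_iff₀ (Real.exp_pos _)]
  exact hle

/-- The companion lower bound, for `H' ≥ -H`; the steps must be at most `1` for the factors to be
non-negative. -/
lemma exp_le_of_step {H : ℝ → ℝ} (h0 : 1 ≤ H 0)
    (h : ∀ z w, 0 ≤ z → z ≤ w → H z * (1 - (w - z)) ≤ H w) {x : ℝ} (hx : 0 ≤ x) :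
    Real.exp (-x) ≤ H x := by
  have key : ∀ n : ℕ, x / n ≤ 1 → ∀ k : ℕ, (1 - x / n) ^ k ≤ H (k * (x / n)) := by
    intro n hn k
    have hd : 0 ≤ x / n := by positivity
    induction k with
    | zero => simpa using h0
    | succ k ih =>
      have := h (k * (x / n)) ((k + 1 : ℕ) * (x / n)) (by positivity) (by gcongr; simp)
      rw [show ((k + 1 : ℕ) : ℝ) * (x / n) - k * (x / n) = x / n by push_cast; ring] at this
      refine le_trans ?_ this
      rw [pow_succ]
      exact mul_le_mul_of_nonneg_right ih (by linarith)
  refine le_of_tendsto (Real.tendsto_one_add_div_pow_exp (-x)) ?_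
  filter_upwards [eventually_gt_atTop 0, eventually_ge_atTop ⌈x⌉₊] with n hn hxn
  have hn' : (0 : ℝ) < n := by positivity
  have := key n (by rw [div_le_one hn']; exact Nat.ceil_le.1 hxn) n
  rw [mul_div_cancel₀ _ hn'.ne'] at this
  rw [neg_div, ← sub_eq_add_neg]
  exact this

/-- With `y = x / (1 + β)`, `exp (-x) = exp (-y) exp (-β y) ≥ exp (-y) (1 - β y)`, and `y exp (-y) ≤
1`. -/
lemma exp_neg_div_sub_exp_neg_le {β x : ℝ} (hβ : 0 ≤ β) :
    Real.exp (-((1 + β)⁻¹ * x)) ≤ Real.exp (-x) + β := by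
  have hb : 0 < 1 + β := by linarith
  set y := (1 + β)⁻¹ * x with hy
  have hxy : x = y + β * y := by rw [hy]; field_simp
  have h1 : 1 - β * y ≤ Real.exp (-(β * y)) := by
    have := Real.add_one_le_exp (-(β * y)); linarith
  have h2 : y * Real.exp (-y) ≤ 1 := by
    rw [Real.exp_neg, ← div_eq_mul_inv, div_le_one (Real.exp_pos _)]
    have := Real.add_one_le_exp y; linarith
  rw [hxy, neg_add, Real.exp_add]
  have h3 := mul_le_mul_of_nonneg_left h1 (Real.exp_pos (-y)).le
  have h4 := mul_le_mul_of_nonneg_left h2 hβ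
  nlinarith

/-- A tail function `G` whose integrated tail `H` is within a shift `β` of `G` is close to the
exponential tail. -/
lemma abs_tail_sub_exp_le {G H : ℝ → ℝ} {β : ℝ} (hβ : 0 ≤ β) (hG : ∀ z, G z ≤ 1)
    (h0 : H 0 = 1)
    (hlow : ∀ z w, 0 ≤ z → z ≤ w → (w - z) * G w ≤ H z - H w)
    (hupp : ∀ z w, 0 ≤ z → z ≤ w → H z - H w ≤ (w - z) * G z)
    (h1 : ∀ z, 0 ≤ z → G (z + β) ≤ H z) (h2 : ∀ z, 0 ≤ z → H z ≤ G (z - β))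
    {x : ℝ} (hx : 0 ≤ x) : |G x - Real.exp (-x)| ≤ 2 * β := by
  -- `H` falls by at most `β` on an interval of length `β`, because `G ≤ 1`. If `z < β` there is no
  -- room to shift left, but then `H z ≥ 1 - z` suffices.
  have hGH : ∀ z, 0 ≤ z → G z ≤ H z + β := by
    intro z hz
    rcases le_total β z with h | h
    · have a := h1 (z - β) (by linarith)
      rw [sub_add_cancel] at a
      have b := hupp (z - β) z (by linarith) (by linarith)
      have c := mul_le_mul_of_nonneg_left (hG (z - β)) hβ
      have e : z - (z - β) = β := by ring
      rw [e] at b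
      linarith
    · have b := hupp 0 z le_rfl hz
      have c := mul_le_mul_of_nonneg_left (hG 0) hz
      have d := hG z
      rw [sub_zero] at b
      linarith
  -- A multiplicative error, unlike in `hGH`: the loss over `[z, z + β]` is at most `β G z`.
  have hHG : ∀ z, 0 ≤ z → H z ≤ G z * (1 + β) := by
    intro z hz
    have a := h2 (z + β) (by linarith)
    rw [add_sub_cancel_right] at a
    have b := hupp z (z + β) hz (by linarith)
    rw [add_sub_cancel_left] at b
    linarith
  have hb : 0 < 1 + β := by linarith
  -- `hHG` makes `H' = -G ≤ -H / (1 + β)`.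
  have hup : H x ≤ Real.exp (-((1 + β)⁻¹ * x)) := by
    refine le_exp_of_step (by positivity) h0.le (fun z w hz hw => ?_) hx
    have a := hlow z w hz hw
    have b : (1 + β)⁻¹ * H w ≤ G w := by
      rw [inv_mul_le_iff₀ hb, mul_comm]; exact hHG w (by linarith)
    have c := mul_le_mul_of_nonneg_left b (sub_nonneg.2 hw)
    linarith
  -- `hGH` makes `(H + β)' = -G ≥ -(H + β)`.
  have hdn : Real.exp (-x) ≤ H x + β := by
    refine exp_le_of_step (H := fun x => H x + β) (by simp [h0, hβ]) (fun z w hz hw => ?_) hx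
    have a := hupp z w hz hw
    have c := mul_le_mul_of_nonneg_left (hGH z hz) (sub_nonneg.2 hw)
    linarith
  have a := hGH x hx
  have b := hHG x hx
  have c := mul_le_mul_of_nonneg_left (hG x) hβ
  have d := exp_neg_div_sub_exp_neg_le (x := x) hβ
  rw [abs_le]
  constructor <;> linarith

lemma integrableOn_mul_exp_neg {h : ℝ → ℝ} (hh : LipschitzWith 1 h) (a : ℝ) :
    IntegrableOn (fun t => h t * Real.exp (-t)) (Set.Ioi a) := by
  refine integrable_of_isBigO_exp_neg (b := 1 / 2) (by norm_num)
    (hh.continuous.mul (by fun_prop)).continuousOn ?_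
  refine Asymptotics.IsBigO.of_bound (|h 0| + 2) ?_
  filter_upwards [eventually_ge_atTop 0] with t ht
  have h1 : |h t| ≤ |h 0| + t := by
    have := hh.dist_le_mul t 0
    rw [Real.dist_eq, Real.dist_eq, sub_zero, abs_of_nonneg ht] at this
    have h3 := abs_sub_abs_le_abs_sub (h t) (h 0)
    simp at this
    linarith
  have h2 := Real.add_one_le_exp (t / 2)
  have h4 : 1 ≤ Real.exp (t / 2) := Real.one_le_exp (by positivity)
  rw [norm_mul, Real.norm_eq_abs, Real.norm_eq_abs, Real.norm_eq_abs, Real.abs_exp, Real.abs_exp,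
    show -t = t * (-1 / 2) + (-(1 / 2) * t) by ring, Real.exp_add, ← mul_assoc]
  refine mul_le_mul_of_nonneg_right ?_ (Real.exp_pos _).le
  rw [show t * (-1 / 2) = -(t / 2) by ring, Real.exp_neg, ← div_eq_mul_inv,
    div_le_iff₀ (Real.exp_pos _)]
  nlinarith [abs_nonneg (h 0)]

lemma integral_expMeasure_one (h : ℝ → ℝ) :
    ∫ x, h x ∂(expMeasure 1) = ∫ t in Set.Ioi 0, h t * Real.exp (-t) := by
  have : expMeasure 1 = volume.withDensity fun x => ENNReal.ofReal (exponentialPDFReal 1 x) := rfl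
  rw [this, integral_withDensity_eq_integral_toReal_smul
    ((measurable_exponentialPDFReal 1).ennreal_ofReal) (by simp),
    ← integral_Ici_eq_integral_Ioi, ← integral_indicator measurableSet_Ici]
  congr 1
  ext t
  by_cases ht : 0 ≤ t
  · rw [← exponentialPDF, exponentialPDF_of_nonneg ht, Set.indicator_of_mem (by exact ht)]
    rw [ENNReal.toReal_ofReal (by positivity)]
    simp [mul_comm]
  · rw [← exponentialPDF, exponentialPDF_of_neg (not_le.1 ht), Set.indicator_of_notMem (by simpa using ht)]
    simp

/-- The Stein equation `f' = f + h - E h(Z)`, `Z ∼ Exp(1)`, has a `1`-Lipschitz solution. -/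
lemma exists_stein_solution {h : ℝ → ℝ} (hh : LipschitzWith 1 h) :
    ∃ f : ℝ → ℝ, f 0 = 0 ∧ LipschitzWith 1 f ∧
      ∀ x, HasDerivAt f (f x + h x - ∫ t, h t ∂(expMeasure 1)) x := by
  rw [integral_expMeasure_one]
  set c := ∫ t in Set.Ioi 0, h t * Real.exp (-t) with hc
  have hE : ∀ a : ℝ, IntegrableOn (fun t => Real.exp (-t)) (Set.Ioi a) := fun a => by
    simpa using integrableOn_mul_exp_neg (LipschitzWith.const' (K := 1) (1 : ℝ)) a
  have hint : ∀ a : ℝ, IntegrableOn (fun t => (h t - c) * Real.exp (-t)) (Set.Ioi a) := fun a => by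
    simp_rw [sub_mul]
    exact (integrableOn_mul_exp_neg hh a).sub ((hE a).const_mul c)
  have hcont : Continuous fun t => (h t - c) * Real.exp (-t) :=
    (hh.continuous.sub continuous_const).mul (by fun_prop)
  have hzero : ∫ t in Set.Ioi 0, (h t - c) * Real.exp (-t) = 0 := by
    simp_rw [sub_mul]
    rw [integral_sub (integrableOn_mul_exp_neg hh 0) ((hE 0).const_mul c), integral_const_mul,
      integral_exp_neg_Ioi_zero]
    simp [hc]
  -- The integral over `(0, ∞)` vanishes, so the integral up to `x` is minus the one beyond `x`. The
  -- left form is easy to differentiate; in the right form `x` enters only through a translate of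
  -- `h`, which gives the Lipschitz constant `1`.
  have hrep : ∀ x, Real.exp x * ∫ t in (0 : ℝ)..x, (h t - c) * Real.exp (-t) =
      -∫ s in Set.Ioi (0 : ℝ), (h (s + x) - c) * Real.exp (-s) := by
    intro x
    have h1 := intervalIntegral.integral_interval_add_Ioi (hint 0) (hint x)
    rw [hzero] at h1
    rw [eq_neg_of_add_eq_zero_left h1, mul_neg, ← integral_const_mul]
    congr 1
    have h2 := (measurePreserving_add_right volume x).setIntegral_preimage_emb
      (measurableEmbedding_addRight x) (fun t => Real.exp x * ((h t - c) * Real.exp (-t)))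
      (Set.Ioi x)
    rw [Set.preimage_add_const_Ioi, sub_self] at h2
    rw [← h2]
    refine setIntegral_congr_fun measurableSet_Ioi fun s _ => ?_
    rw [neg_add, Real.exp_add, Real.exp_neg x]
    field_simp
  have hshift : ∀ x : ℝ, LipschitzWith 1 fun s => h (s + x) := fun x => by
    refine LipschitzWith.of_dist_le_mul fun s t => ?_
    simpa using hh.dist_le_mul (s + x) (t + x)
  have hint' : ∀ x : ℝ,
      IntegrableOn (fun s => (h (s + x) - c) * Real.exp (-s)) (Set.Ioi 0) := fun x => by
    simp_rw [sub_mul]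
    exact (integrableOn_mul_exp_neg (hshift x) 0).sub ((hE 0).const_mul c)
  refine ⟨fun x => Real.exp x * ∫ t in (0 : ℝ)..x, (h t - c) * Real.exp (-t), by simp, ?_, ?_⟩
  · refine LipschitzWith.of_dist_le_mul fun x y => ?_
    rw [hrep, hrep, dist_neg_neg, dist_eq_norm, ← integral_sub (hint' x) (hint' y)]
    calc _ ≤ ∫ s in Set.Ioi (0 : ℝ), dist x y * Real.exp (-s) := by
          refine norm_integral_le_of_norm_le ((hE 0).const_mul _) (ae_of_all _ fun s => ?_)
          rw [← sub_mul, norm_mul, Real.norm_eq_abs (Real.exp _), Real.abs_exp]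
          refine mul_le_mul_of_nonneg_right ?_ (Real.exp_pos _).le
          have := hh.dist_le_mul (s + x) (s + y)
          rw [dist_add_left] at this
          rw [sub_sub_sub_cancel_right, ← dist_eq_norm]
          simpa using this
      _ = _ := by rw [integral_const_mul, integral_exp_neg_Ioi_zero]; simp
  · intro x
    have h1 := (hcont.integral_hasStrictDerivAt 0 x).hasDerivAt
    convert! (Real.hasDerivAt_exp x).mul h1 using 1
    rw [add_sub_assoc]
    congr 1
    rw [mul_comm (h x - c), ← mul_assoc, ← Real.exp_add]
    simp

end Analysis

/-! ### Quantile functions and shifted distribution functions -/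

section Quantile

/-- Right-continuity of the distribution function makes the infimum attained. -/
lemma quantile_le_iff {ν : Measure ℝ} [IsProbabilityMeasure ν] {u x : ℝ}
    (hu : u ∈ Set.Ioo (0 : ℝ) 1) : quantile ν u ≤ x ↔ u ≤ cdf ν x := by
  have hne : {x : ℝ | u ≤ cdf ν x}.Nonempty :=
    ((tendsto_cdf_atTop ν).eventually (eventually_ge_nhds hu.2)).exists
  have hbdd : BddBelow {x : ℝ | u ≤ cdf ν x} := by
    obtain ⟨y, hy⟩ := ((tendsto_cdf_atBot ν).eventually (eventually_lt_nhds hu.1)).exists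
    refine ⟨y, fun x hx => ?_⟩
    by_contra! h
    exact absurd (hx.trans (monotone_cdf ν h.le)) (not_le.2 hy)
  refine ⟨fun h => ?_, fun h => csInf_le hbdd h⟩
  refine le_trans ?_ (monotone_cdf ν h)
  have hr := ((cdf ν).right_continuous (quantile ν u)).tendsto.mono_left
    (nhdsWithin_mono _ Set.Ioi_subset_Ici_self)
  refine ge_of_tendsto hr ?_
  filter_upwards [self_mem_nhdsWithin] with y hy
  obtain ⟨x, hx, hxy⟩ := exists_lt_of_csInf_lt hne hy
  exact le_trans hx (monotone_cdf ν hxy.le)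

lemma quantileDist_comm (ν ν' : Measure ℝ) : quantileDist ν ν' = quantileDist ν' ν := by
  simp_rw [quantileDist, abs_sub_comm]

lemma measure_Iio_le_of_quantileDist_le {ν ν' : Measure ℝ} [IsProbabilityMeasure ν]
    [IsProbabilityMeasure ν'] {δ : ℝ} (hδ : 0 ≤ δ)
    (h : quantileDist ν ν' ≤ ENNReal.ofReal δ) (z : ℝ) :
    ν (Set.Iio z) ≤ ν' (Set.Iio (z + δ)) := by
  have hcdf : ∀ x, cdf ν x ≤ cdf ν' (x + δ) := by
    intro x
    -- Levels `v` strictly below `cdf ν x` avoid the level `1`, where the quantile distance gives no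
    -- control.
    refine le_of_forall_lt_imp_le_of_dense fun v hv => ?_
    rcases le_or_gt v 0 with h0 | h0
    · exact h0.trans (cdf_nonneg _ _)
    have hv1 : v ∈ Set.Ioo (0 : ℝ) 1 := ⟨h0, hv.trans_le (cdf_le_one _ _)⟩
    rw [← quantile_le_iff hv1]
    have h1 := (quantile_le_iff hv1).2 hv.le
    have h2 : |quantile ν v - quantile ν' v| ≤ δ :=
      (ENNReal.ofReal_le_ofReal_iff hδ).1 ((le_iSup₂_of_le v hv1 le_rfl).trans h)
    have := (abs_le.1 h2).1
    linarith
  have hIic : ∀ x, ν (Set.Iic x) ≤ ν' (Set.Iic (x + δ)) := fun x => by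
    rw [← ofReal_cdf, ← ofReal_cdf]
    exact ENNReal.ofReal_le_ofReal (hcdf x)
  obtain ⟨u, hu_mono, hu_lt, hu_lim⟩ := exists_seq_strictMono_tendsto z
  have hU : Set.Iio z = ⋃ n, Set.Iic (u n) := by
    ext x
    simp only [Set.mem_Iio, Set.mem_iUnion, Set.mem_Iic]
    refine ⟨fun hx => ?_, fun ⟨n, hn⟩ => hn.trans_lt (hu_lt n)⟩
    exact (hu_lim.eventually (eventually_ge_nhds hx)).exists
  rw [hU, Monotone.measure_iUnion (fun a b hab => Set.Iic_subset_Iic.2 (hu_mono.monotone hab))]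
  exact iSup_le fun n => (hIic _).trans
    (measure_mono fun x hx => lt_of_le_of_lt hx (add_lt_add_left (hu_lt n) δ))

end Quantile

/-! ### Evaluation at a random index -/

section Auxiliary

variable {Ω : Type*} [MeasurableSpace Ω] {P : Measure Ω}

lemma hasSum_congr {f g : ℕ → ℝ} {a : ℝ} (h : ∀ n, f n = g n) : HasSum f a ↔ HasSum g a := by
  rw [funext h]

lemma measurable_eval_nat {T : ℕ → Ω → ℝ} (hT : ∀ k, Measurable (T k)) {M : Ω → ℕ}
    (hM : Measurable M) : Measurable fun ω => T (M ω) ω :=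
  (measurable_from_prod_countable_right (f := fun p : ℕ × Ω => T p.1 p.2) hT).comp
    (hM.prodMk measurable_id)

/-- Nothing is known about `T 0`, so the modification puts `0` at that index. -/
lemma aemeasurable_eval_nat {T : ℕ → Ω → ℝ} (hT : ∀ k ≥ 1, Measurable (T k)) {M : Ω → ℕ}
    (hM : Measurable M) (hM1 : ∀ᵐ ω ∂P, 1 ≤ M ω) : AEMeasurable (fun ω => T (M ω) ω) P := by
  refine ⟨fun ω => (if 1 ≤ M ω then T (M ω) ω else 0),
    measurable_eval_nat (T := fun k ω => if 1 ≤ k then T k ω else 0) (fun k => ?_) hM, ?_⟩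
  · by_cases hk : 1 ≤ k
    · simpa [hk] using hT k hk
    · simp [hk]
  · filter_upwards [hM1] with ω hω
    simp [hω]

lemma integral_ite_of_indepFun {Z : Ω → ℝ} {T : Ω → ℕ} (h : IndepFun Z T P)
    (hZ : Measurable Z) (hT : Measurable T) (p : ℕ → Prop) [DecidablePred p] :
    ∫ ω, (if p (T ω) then Z ω else 0) ∂P = P.real {ω | p (T ω)} * ∫ ω, Z ω ∂P := by
  have h1 := h.integral_fun_comp_mul_comp (f := id) (g := fun k => if p k then (1 : ℝ) else 0)
    hZ.aemeasurable hT.aemeasurable measurable_id.aestronglyMeasurable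
    (measurable_of_countable _).aestronglyMeasurable
  have h2 : ∫ ω, (if p (T ω) then (1 : ℝ) else 0) ∂P = P.real {ω | p (T ω)} := by
    have hm : MeasurableSet {ω | p (T ω)} := hT (Set.to_countable {k | p k}).measurableSet
    rw [← integral_indicator_one hm]
    simp [Set.indicator_apply]
  simp only [id, mul_ite, mul_one, mul_zero, h2] at h1
  rw [h1, mul_comm]

/-- Conditioning on the value of an independent random index. -/
lemma hasSum_integral_eval_nat [IsProbabilityMeasure P] {T : ℕ → Ω → ℝ}
    (hT : ∀ k ≥ 1, Measurable (T k)) {B : ℝ} (hB : ∀ k ≥ 1, ∀ ω, |T k ω| ≤ B) {M : Ω → ℕ}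
    (hM : Measurable M) (hM1 : ∀ᵐ ω ∂P, 1 ≤ M ω) (hind : ∀ k ≥ 1, IndepFun (T k) M P) :
    HasSum (fun n => P.real {ω | M ω = n + 1} * ∫ ω, T (n + 1) ω ∂P) (∫ ω, T (M ω) ω ∂P) := by
  have hs : ∀ (c : ℕ → ℝ) (k : ℕ), 1 ≤ k →
      HasSum (fun n => if k = n + 1 then c (n + 1) else 0) (c k) := by
    intro c k hk
    obtain ⟨k, rfl⟩ := Nat.exists_eq_add_of_le' hk
    convert hasSum_ite_eq k (c (k + 1)) using 2 with n
    simp only [Nat.add_right_cancel_iff, eq_comm (a := k)]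
    split_ifs with h
    · rw [h]
    · rfl
  have hmeas : ∀ n, MeasurableSet {ω | M ω = n + 1} := fun n => hM (measurableSet_singleton _)
  have key := hasSum_integral_of_dominated_convergence (μ := P)
    (F := fun n ω => if M ω = n + 1 then T (n + 1) ω else 0) (f := fun ω => T (M ω) ω)
    (fun n ω => if M ω = n + 1 then B else 0)
    (fun n => (Measurable.ite (hmeas n) (hT _ (by simp)) measurable_const).aestronglyMeasurable)
    (fun n => ae_of_all _ fun ω => by
      split_ifs with h
      · exact hB _ (by simp) ω
      · simp)
    (by filter_upwards [hM1] with ω hω using (hs (fun _ => B) _ hω).summable)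
    ((integrable_const B).congr (by
      filter_upwards [hM1] with ω hω using (hs (fun _ => B) _ hω).tsum_eq.symm))
    (by filter_upwards [hM1] with ω hω using hs (fun k => T k ω) _ hω)
  exact (hasSum_congr fun n => (integral_ite_of_indepFun (hind (n + 1) (by simp))
    (hT _ (by simp)) hM (· = n + 1)).symm).2 key

end Auxiliary

/-! ### Disintegration over the past -/

section CondLaw

variable {Ω : Type*} [MeasurableSpace Ω] {P : Measure Ω} [IsProbabilityMeasure P]
  {X : ℕ → Ω → ℝ}

instance (i : ℕ) (Y : Ω → ℝ) (ω : Ω) : IsProbabilityMeasure (condLaw P X i Y ω) := by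
  unfold condLaw; infer_instance

lemma measurable_past (hX : ∀ i ≥ 1, Measurable (X i)) (i : ℕ) : Measurable (past X i) :=
  measurable_pi_lambda _ fun j => hX _ (Finset.mem_Ico.1 j.2).1

lemma integral_integral_condLaw (hX : ∀ i ≥ 1, Measurable (X i)) (i : ℕ) {Y : Ω → ℝ}
    (hY : Measurable Y) {g : (Finset.Ico 1 i → ℝ) × ℝ → ℝ} (hg : Measurable g)
    (hint : Integrable (fun ω => g (past X i ω, Y ω)) P) :
    ∫ ω, ∫ y, g (past X i ω, y) ∂(condLaw P X i Y ω) ∂P = ∫ ω, g (past X i ω, Y ω) ∂P := by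
  have h := condExp_prod_ae_eq_integral_condDistrib (μ := P) (measurable_past hX i)
    hY.aemeasurable hg.stronglyMeasurable hint
  rw [← integral_condExp (measurable_past hX i).comap_le (f := fun ω => g (past X i ω, Y ω))]
  exact (integral_congr_ae h).symm

lemma ae_integrable_condLaw (hX : ∀ i ≥ 1, Measurable (X i)) (i : ℕ) {Y : Ω → ℝ}
    (hY : Measurable Y) {g : (Finset.Ico 1 i → ℝ) × ℝ → ℝ} (hg : Measurable g)
    (hint : Integrable (fun ω => g (past X i ω, Y ω)) P) :
    ∀ᵐ ω ∂P, Integrable (fun y => g (past X i ω, y)) (condLaw P X i Y ω) := by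
  refine Integrable.condDistrib_ae (μ := P) (measurable_past hX i).aemeasurable
    hY.aemeasurable ?_
  exact (integrable_map_measure hg.aestronglyMeasurable
    ((measurable_past hX i).prodMk hY).aemeasurable).2 hint

lemma lintegral_condLaw_Iio (hX : ∀ i ≥ 1, Measurable (X i)) (i : ℕ) {Y : Ω → ℝ}
    (hY : Measurable Y) {s : (Finset.Ico 1 i → ℝ) → ℝ} (hs : Measurable s) (z : ℝ) :
    ∫⁻ ω, condLaw P X i Y ω (Set.Iio (z - s (past X i ω))) ∂P =
      P {ω | s (past X i ω) + Y ω < z} := by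
  have hA : MeasurableSet {p : (Finset.Ico 1 i → ℝ) × ℝ | s p.1 + p.2 < z} :=
    measurableSet_lt (by fun_prop) measurable_const
  have h1 := congrArg (fun ν : Measure ((Finset.Ico 1 i → ℝ) × ℝ) => ν {p : (Finset.Ico 1 i → ℝ) × ℝ | s p.1 + p.2 < z})
    (compProd_map_condDistrib (μ := P) (X := past X i) hY.aemeasurable)
  rw [Measure.map_apply ((measurable_past hX i).prodMk hY) hA, Measure.compProd_apply hA,
    lintegral_map (Kernel.measurable_kernel_prodMk_left hA) (measurable_past hX i)] at h1
  refine Eq.trans (lintegral_congr fun ω => ?_) h1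
  unfold condLaw
  congr 1
  ext y
  simp [lt_sub_iff_add_lt']

/-- Given the past, `s` is a constant, so the unconditional inequality is the average of conditional
ones. -/
lemma measure_lt_le_of_quantileDist_le (hX : ∀ i ≥ 1, Measurable (X i)) (i : ℕ) {Y Y' : Ω → ℝ}
    (hY : Measurable Y) (hY' : Measurable Y') {s : (Finset.Ico 1 i → ℝ) → ℝ} (hs : Measurable s)
    {δ : ℝ} (hδ : 0 ≤ δ)
    (h : ∀ᵐ ω ∂P, quantileDist (condLaw P X i Y ω) (condLaw P X i Y' ω) ≤ ENNReal.ofReal δ)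
    (z : ℝ) :
    P.real {ω | s (past X i ω) + Y ω < z} ≤ P.real {ω | s (past X i ω) + Y' ω < z + δ} := by
  refine ENNReal.toReal_mono (measure_ne_top _ _) ?_
  rw [← lintegral_condLaw_Iio hX i hY hs, ← lintegral_condLaw_Iio hX i hY' hs]
  refine lintegral_mono_ae ?_
  filter_upwards [h] with ω hω
  rw [add_sub_right_comm]
  exact measure_Iio_le_of_quantileDist_le hδ hω _

end CondLaw

/-! ### From an approximate equilibrium identity to the Kolmogorov distance -/

section ExponentialApproximation

lemma integrable_min {ρ : Measure ℝ} [IsProbabilityMeasure ρ] (hR : ∀ᵐ x ∂ρ, 0 ≤ x) {z : ℝ}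
    (hz : 0 ≤ z) : Integrable (fun x => min x z) ρ := by
  refine (integrable_const z).mono' (by fun_prop) ?_
  filter_upwards [hR] with x hx
  rw [Real.norm_eq_abs, abs_of_nonneg (le_min hx hz)]
  exact min_le_right _ _

/-- `z ↦ ∫ min x z ∂ρ` is the integral of the tail `G` over `[0, z]`, so the hypotheses compare `ρ`
with its integrated tail up to a shift `β`, as `abs_tail_sub_exp_le` requires. -/
lemma dK_expMeasure_le {ρ : Measure ℝ} [IsProbabilityMeasure ρ] (hR : ∀ᵐ x ∂ρ, 0 ≤ x) {β : ℝ}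
    (hβ : 0 ≤ β) (h1 : ∀ z, 0 ≤ z → ρ.real (Set.Iio (z - β)) ≤ ∫ x, min x z ∂ρ)
    (h2 : ∀ z, 0 ≤ z → ∫ x, min x z ∂ρ ≤ ρ.real (Set.Iio (z + β))) :
    dK ρ (expMeasure 1) ≤ ENNReal.ofReal (2 * β) := by
  have := isProbabilityMeasure_expMeasure zero_lt_one
  set G : ℝ → ℝ := fun z => ρ.real (Set.Ici z) with hG
  have hGIio : ∀ z, ρ.real (Set.Iio z) = 1 - G z := fun z => by
    rw [← Set.compl_Ici, probReal_compl_eq_one_sub measurableSet_Ici]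
  have hind : ∀ z c, ∫ x, (Set.Ici z).indicator (fun _ => c) x ∂ρ = c * G z := fun z c => by
    rw [integral_indicator_const _ measurableSet_Ici, smul_eq_mul, mul_comm]
  have hdiff : ∀ z w, 0 ≤ z → z ≤ w → ∫ x, min x w ∂ρ - ∫ x, min x z ∂ρ =
      ∫ x, (min x w - min x z) ∂ρ := fun z w hz hw =>
    (integral_sub (integrable_min hR (hz.trans hw)) (integrable_min hR hz)).symm
  have hmain : ∀ x, 0 ≤ x → |G x - Real.exp (-x)| ≤ 2 * β := by
    intro x hx
    refine abs_tail_sub_exp_le (G := G) (H := fun z => 1 - ∫ x, min x z ∂ρ) hβ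
      (fun z => measureReal_le_one) ?_ ?_ ?_ ?_ ?_ hx
    · have : ∫ x, min x 0 ∂ρ = 0 := by
        exact integral_eq_zero_of_ae (by filter_upwards [hR] with x hx using min_eq_right hx)
      simp [this]
    · intro z w hz hw
      rw [sub_sub_sub_cancel_left, hdiff z w hz hw, ← hind]
      refine integral_mono ((integrable_const _).indicator measurableSet_Ici)
        ((integrable_min hR (hz.trans hw)).sub (integrable_min hR hz)) fun x => ?_
      by_cases hx : w ≤ x
      · simp [hx, hw.trans hx]
      · simp only [Set.mem_Ici, hx, not_false_eq_true, Set.indicator_of_notMem, sub_nonneg]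
        exact min_le_min_left _ hw
    · intro z w hz hw
      rw [sub_sub_sub_cancel_left, hdiff z w hz hw, ← hind]
      refine integral_mono ((integrable_min hR (hz.trans hw)).sub (integrable_min hR hz))
        ((integrable_const _).indicator measurableSet_Ici) fun x => ?_
      by_cases hx : z ≤ x
      · simp [hx]
      · have : x ≤ z := (not_le.1 hx).le
        simp [hx, this, this.trans hw]
    · intro z hz
      have := h2 z hz
      rw [hGIio] at this
      linarith
    · intro z hz
      have := h1 z hz
      rw [hGIio] at this
      linarith
  refine iSup₂_le fun f hf => ENNReal.ofReal_le_ofReal ?_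
  obtain ⟨z, rfl⟩ := hf
  rw [integral_indicator_const _ measurableSet_Iic, integral_indicator_const _ measurableSet_Iic,
    smul_eq_mul, smul_eq_mul, mul_one, mul_one, ← cdf_eq_real (expMeasure 1),
    cdf_expMeasure_eq zero_lt_one]
  have hIoi : ρ.real (Set.Iic z) = 1 - ρ.real (Set.Ioi z) := by
    rw [← Set.compl_Ioi, probReal_compl_eq_one_sub measurableSet_Ioi]
  split_ifs with hz
  · rw [one_mul, hIoi, sub_sub_sub_cancel_left, abs_sub_comm, abs_le]
    constructor
    -- The distance involves `ρ (z, ∞)`, whereas `hmain` concerns closed half-lines `[w, ∞)`; let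
    -- `w` decrease to `z`.
    · have hlim : Tendsto (fun w => Real.exp (-w) - 2 * β) (𝓝[>] z)
          (𝓝 (Real.exp (-z) - 2 * β)) :=
        (Continuous.tendsto (by fun_prop) z).mono_left nhdsWithin_le_nhds
      have : Real.exp (-z) - 2 * β ≤ ρ.real (Set.Ioi z) := by
        refine le_of_tendsto hlim ?_
        filter_upwards [self_mem_nhdsWithin] with w hw
        have a := (abs_le.1 (hmain w (hz.trans (le_of_lt hw)))).1
        have b : G w ≤ ρ.real (Set.Ioi z) := measureReal_mono (Set.Ici_subset_Ioi.2 hw)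
        linarith
      linarith
    · have a := (abs_le.1 (hmain z hz)).2
      have b : ρ.real (Set.Ioi z) ≤ G z := measureReal_mono Set.Ioi_subset_Ici_self
      linarith
  · have : ρ.real (Set.Iic z) = 0 := by
      rw [measureReal_def, measure_eq_zero_iff_ae_notMem.2, ENNReal.toReal_zero]
      filter_upwards [hR] with x hx hxz
      exact hz (hx.trans hxz)
    rw [this]
    simpa using hβ

end ExponentialApproximation

/-! ### The random sum and its equilibrium distribution -/

variable {Ω : Type*}

/-- The partial sum `X 1 + ... + X n`. -/
def partialSum (X : ℕ → Ω → ℝ) (n : ℕ) (ω : Ω) : ℝ := ∑ j ∈ Finset.range n, X (j + 1) ω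

/-- A random sum with non-negative summands of constant conditional means `m i`, an independent
number of summands `N`, an independent index `M`, and equilibrium variables `Xe i`. -/
structure IsModel [MeasurableSpace Ω] (P : Measure Ω) [IsProbabilityMeasure P] (X : ℕ → Ω → ℝ) (m : ℕ → ℝ)
    (N M : Ω → ℕ) (μ : ℝ) (Xe : ℕ → Ω → ℝ) : Prop where
  measurable_X : ∀ i ≥ 1, Measurable (X i)
  integrable_X : ∀ i ≥ 1, Integrable (X i) P
  nonneg : ∀ i ≥ 1, ∀ᵐ ω ∂P, 0 ≤ X i ω
  mean : ∀ i ≥ 1, P[X i | MeasurableSpace.comap (past X i) inferInstance] =ᵐ[P] fun _ => m i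
  measurable_N : Measurable N
  integrable_sum : Integrable (fun ω => partialSum X (N ω) ω) P
  integral_sum : ∫ ω, partialSum X (N ω) ω ∂P = μ
  pos : 0 < μ
  measurable_M : Measurable M
  law_M : ∀ k ≥ 1, P.real {ω | M ω = k} = m k * P.real {ω | k ≤ N ω} / μ
  measurable_Xe : ∀ i ≥ 1, Measurable (Xe i)
  equilibrium : ∀ i ≥ 1, ∀ᵐ ω ∂P, IsEquilibrium (condLaw P X i (X i) ω) (condLaw P X i (Xe i) ω)
  indep : ∀ i ≥ 1, IndepFun (fun ω => ((fun j : Set.Ici (1 : ℕ) => X j ω), Xe i ω))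
    (fun ω => (N ω, M ω)) P

lemma randomSum_eq_partialSum (X : ℕ → Ω → ℝ) (N : Ω → ℕ) :
    randomSum X N = fun ω => partialSum X (N ω) ω := by
  ext ω
  rw [randomSum, partialSum, Finset.range_eq_Ico, Finset.sum_Ico_add' (fun j => X j ω) 0 (N ω) 1]
  rfl

lemma partialSum_succ (X : ℕ → Ω → ℝ) (n : ℕ) (ω : Ω) :
    partialSum X (n + 1) ω = partialSum X n ω + X (n + 1) ω := Finset.sum_range_succ _ _

lemma sum_past (X : ℕ → Ω → ℝ) (n : ℕ) (ω : Ω) :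
    ∑ j, past X (n + 1) ω j = partialSum X n ω := by
  simp only [past]
  rw [Finset.sum_coe_sort (Finset.Ico 1 (n + 1)) (fun j => X j ω), partialSum,
    Finset.range_eq_Ico, Finset.sum_Ico_add' (fun j => X j ω) 0 n 1]

lemma measurable_partialSum [MeasurableSpace Ω] {X : ℕ → Ω → ℝ} (hX : ∀ i ≥ 1, Measurable (X i)) (n : ℕ) :
    Measurable (partialSum X n) :=
  Finset.measurable_fun_sum _ fun j _ => hX (j + 1) (by simp)

lemma hasSum_ite_sub (a : ℕ → ℝ) (k : ℕ) :
    HasSum (fun n => if n + 1 ≤ k then a (n + 1) - a n else 0) (a k - a 0) := by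
  have h : ∑ n ∈ Finset.range k, (if n + 1 ≤ k then a (n + 1) - a n else 0) = a k - a 0 := by
    rw [← Finset.sum_range_sub]
    exact Finset.sum_congr rfl fun n hn => if_pos (Finset.mem_range.1 hn)
  rw [← h]
  exact hasSum_sum_of_ne_finset_zero fun n hn => if_neg (by simpa using hn)

namespace IsModel

variable [MeasurableSpace Ω] {P : Measure Ω} [IsProbabilityMeasure P] {X : ℕ → Ω → ℝ}
  {m : ℕ → ℝ} {N M : Ω → ℕ} {μ : ℝ} {Xe : ℕ → Ω → ℝ} (h : IsModel P X m N M μ Xe)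

include h

lemma integral_X {i : ℕ} (hi : 1 ≤ i) : ∫ ω, X i ω ∂P = m i := by
  rw [← integral_condExp (measurable_past h.measurable_X i).comap_le,
    integral_congr_ae (h.mean i hi)]
  simp

lemma ae_nonneg : ∀ᵐ ω ∂P, ∀ n, 0 ≤ X (n + 1) ω :=
  ae_all_iff.2 fun n => h.nonneg _ (by simp)

lemma indep_comp {φ : (Set.Ici (1 : ℕ) → ℝ) × ℝ → ℝ} (hφ : Measurable φ) {i : ℕ} (hi : 1 ≤ i) :
    IndepFun (fun ω => φ ((fun j : Set.Ici (1 : ℕ) => X j ω), Xe i ω)) N P ∧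
    IndepFun (fun ω => φ ((fun j : Set.Ici (1 : ℕ) => X j ω), Xe i ω)) M P :=
  ⟨(h.indep i hi).comp hφ measurable_fst, (h.indep i hi).comp hφ measurable_snd⟩

/-- Any measurable function of `S n, X (n + 1), Xe (n + 1)` is independent of `N` and of `M`. -/
lemma indep_summand {φ : ℝ × ℝ × ℝ → ℝ} (hφ : Measurable φ) (n : ℕ) :
    IndepFun (fun ω => φ (partialSum X n ω, X (n + 1) ω, Xe (n + 1) ω)) N P ∧
    IndepFun (fun ω => φ (partialSum X n ω, X (n + 1) ω, Xe (n + 1) ω)) M P :=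
  h.indep_comp (φ := fun p => φ (∑ j ∈ Finset.range n, p.1 ⟨j + 1, by simp⟩,
    p.1 ⟨n + 1, by simp⟩, p.2)) (hφ.comp (by fun_prop)) (by simp)

lemma integral_id_condLaw {i : ℕ} (hi : 1 ≤ i) :
    ∀ᵐ ω ∂P, ∫ y, y ∂(condLaw P X i (X i) ω) = m i := by
  have h1 := condExp_ae_eq_integral_condDistrib' (μ := P) (measurable_past h.measurable_X i)
    (h.integrable_X i hi)
  filter_upwards [h1, h.mean i hi] with ω h1 h2
  rw [condLaw, ← h1, h2]

lemma integrable_lipschitz_sub {f : ℝ → ℝ} {L : NNReal} (hf : LipschitzWith L f) (n : ℕ) :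
    Integrable (fun ω => f (partialSum X (n + 1) ω) - f (partialSum X n ω)) P := by
  have hm := measurable_partialSum h.measurable_X
  refine ((h.integrable_X (n + 1) (by simp)).norm.const_mul L).mono'
    ((hf.continuous.measurable.comp (hm (n + 1))).sub
      (hf.continuous.measurable.comp (hm n))).aestronglyMeasurable (ae_of_all _ fun ω => ?_)
  have := hf.dist_le_mul (partialSum X (n + 1) ω) (partialSum X n ω)
  rw [dist_eq_norm, dist_eq_norm, partialSum_succ, add_sub_cancel_left] at this
  rwa [partialSum_succ]

lemma integral_lipschitz_sub {f : ℝ → ℝ} {L : NNReal} (hf : LipschitzWith L f) (n : ℕ) :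
    ∫ ω, (f (partialSum X (n + 1) ω) - f (partialSum X n ω)) ∂P =
      m (n + 1) * ∫ ω, deriv f (partialSum X n ω + Xe (n + 1) ω) ∂P := by
  have hn : 1 ≤ n + 1 := by simp
  have hint := h.integrable_lipschitz_sub hf n
  simp only [partialSum_succ, ← sum_past] at hint ⊢
  have hfm := hf.continuous.measurable
  have hg : Measurable fun p : (Finset.Ico 1 (n + 1) → ℝ) × ℝ =>
      f (∑ j, p.1 j + p.2) - f (∑ j, p.1 j) := by fun_prop
  have hg' : Measurable fun p : (Finset.Ico 1 (n + 1) → ℝ) × ℝ =>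
      deriv f (∑ j, p.1 j + p.2) := (measurable_deriv f).comp (by fun_prop)
  have hint' : Integrable (fun ω => deriv f (∑ j, past X (n + 1) ω j + Xe (n + 1) ω)) P := by
    refine (integrable_const (L : ℝ)).mono' (hg'.comp ((measurable_past h.measurable_X
      (n + 1)).prodMk (h.measurable_Xe (n + 1) hn))).aestronglyMeasurable
      (ae_of_all _ fun ω => norm_deriv_le_of_lipschitz hf)
  rw [← integral_integral_condLaw h.measurable_X (n + 1) (h.measurable_X (n + 1) hn) hg hint,
    ← integral_integral_condLaw h.measurable_X (n + 1) (h.measurable_Xe (n + 1) hn) hg' hint',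
    ← integral_const_mul]
  refine integral_congr_ae ?_
  filter_upwards [h.integral_id_condLaw hn, h.equilibrium (n + 1) hn,
    ae_integrable_condLaw h.measurable_X (n + 1) (h.measurable_X (n + 1) hn) hg hint]
    with ω h1 h2 h3
  set s := ∑ j, past X (n + 1) ω j
  -- The past sum `s` is frozen, so the equilibrium identity is applied to the translate of `f` by
  -- `s`.
  have hs : LipschitzWith L fun x => f (s + x) := by
    refine LipschitzWith.of_dist_le_mul fun x y => ?_
    simpa using hf.dist_le_mul (s + x) (s + y)
  have h4 := h2 _ ⟨L, hs⟩
  have h5 : Integrable (fun x => f (s + x)) (condLaw P X (n + 1) (X (n + 1)) ω) := by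
    exact (h3.add (integrable_const (f s))).congr (ae_of_all _ fun x => by simp [s])
  simp only [h1, deriv_comp_const_add, add_zero] at h4
  rw [integral_sub h5 (integrable_const _), integral_const]
  simpa using h4

lemma integrable_lipschitz {f : ℝ → ℝ} {L : NNReal} (hf : LipschitzWith L f) :
    Integrable (fun ω => f (partialSum X (N ω) ω)) P := by
  have hm := measurable_eval_nat (measurable_partialSum h.measurable_X) h.measurable_N
  refine ((h.integrable_sum.norm.const_mul L).add (integrable_const |f 0|)).mono'
    (hf.continuous.measurable.comp hm).aestronglyMeasurable (ae_of_all _ fun ω => ?_)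
  have := hf.dist_le_mul (partialSum X (N ω) ω) 0
  rw [dist_eq_norm, dist_eq_norm, sub_zero] at this
  have h3 := norm_sub_norm_le (f (partialSum X (N ω) ω)) (f 0)
  simp only [Pi.add_apply, ← Real.norm_eq_abs]
  linarith

/-- Telescoping of `f (S N) - f 0`. The increments are dominated by `L X (n+1)` on `n + 1 ≤ N`,
which sum to the integrable `L S N`; independence of `N` factors each term. -/
lemma hasSum_prob_mul_integral_sub {f : ℝ → ℝ} {L : NNReal} (hf : LipschitzWith L f) :
    HasSum (fun n => P.real {ω | n + 1 ≤ N ω} *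
        ∫ ω, (f (partialSum X (n + 1) ω) - f (partialSum X n ω)) ∂P)
      (∫ ω, f (partialSum X (N ω) ω) ∂P - f 0) := by
  have hm := measurable_partialSum h.measurable_X
  have hfm := hf.continuous.measurable
  have hset : ∀ n, MeasurableSet {ω | n + 1 ≤ N ω} := fun n =>
    measurableSet_le measurable_const h.measurable_N
  have hbd : ∀ ω, HasSum (fun n => (if n + 1 ≤ N ω then L * X (n + 1) ω else 0))
      (L * partialSum X (N ω) ω) := fun ω => by
    have := hasSum_ite_sub (fun n => L * partialSum X n ω) (N ω)
    simp only [partialSum_succ, mul_add, add_sub_cancel_left] at this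
    simpa [partialSum] using this
  have hsub : ∀ n ω, f (partialSum X (n + 1) ω) - f (partialSum X n ω) =
      f (partialSum X n ω + X (n + 1) ω) - f (partialSum X n ω) := fun n ω => by
    rw [partialSum_succ]
  have key := hasSum_integral_of_dominated_convergence (μ := P)
    (F := fun n ω => if n + 1 ≤ N ω then
      f (partialSum X (n + 1) ω) - f (partialSum X n ω) else 0)
    (f := fun ω => f (partialSum X (N ω) ω) - f 0)
    (fun n ω => if n + 1 ≤ N ω then L * X (n + 1) ω else 0)
    (fun n => (Measurable.ite (hset n)
      ((hfm.comp (hm (n + 1))).sub (hfm.comp (hm n))) measurable_const).aestronglyMeasurable)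
    (fun n => by
      filter_upwards [h.ae_nonneg] with ω hω
      split_ifs
      · have := hf.dist_le_mul (partialSum X (n + 1) ω) (partialSum X n ω)
        rw [dist_eq_norm, dist_eq_norm, partialSum_succ, add_sub_cancel_left,
          Real.norm_of_nonneg (hω n)] at this
        rwa [partialSum_succ]
      · simp)
    (ae_of_all _ fun ω => (hbd ω).summable)
    ((h.integrable_sum.const_mul L).congr (ae_of_all _ fun ω => (hbd ω).tsum_eq.symm))
    (ae_of_all _ fun ω => by
      have := hasSum_ite_sub (fun n => f (partialSum X n ω)) (N ω)
      simpa [partialSum] using this)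
  rw [integral_sub (h.integrable_lipschitz hf) (integrable_const _), integral_const] at key
  simp only [probReal_univ, one_smul] at key
  refine (hasSum_congr fun n => ?_).2 key
  refine (integral_ite_of_indepFun ?_ ?_ h.measurable_N (n + 1 ≤ ·)).symm
  · simp only [hsub]
    exact (h.indep_summand (φ := fun p => f (p.1 + p.2.1) - f p.1) (by fun_prop) n).1
  · exact (hfm.comp (hm (n + 1))).sub (hfm.comp (hm n))

lemma hasSum_mean : HasSum (fun n => m (n + 1) * P.real {ω | n + 1 ≤ N ω}) μ := by
  have key := h.hasSum_prob_mul_integral_sub LipschitzWith.id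
  simp only [id, h.integral_sum, sub_zero, partialSum_succ, add_sub_cancel_left] at key
  refine (hasSum_congr fun n => ?_).2 key
  rw [h.integral_X (by simp), mul_comm]

lemma mean_mul_prob (n : ℕ) :
    m (n + 1) * P.real {ω | n + 1 ≤ N ω} = μ * P.real {ω | M ω = n + 1} := by
  rw [h.law_M (n + 1) (by simp), mul_div_cancel₀ _ h.pos.ne']

/-- The law of `M` is prescribed only on `k ≥ 1`; by `hasSum_mean` these masses already sum to `1`.
-/
lemma one_le_M : ∀ᵐ ω ∂P, 1 ≤ M ω := by
  have hs : HasSum (fun n => P.real {ω | M ω = n + 1}) 1 := by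
    have := h.hasSum_mean.mul_left μ⁻¹
    simp only [h.mean_mul_prob, inv_mul_cancel_left₀ h.pos.ne', inv_mul_cancel₀ h.pos.ne'] at this
    exact this
  have hmeas : ∀ n, MeasurableSet {ω | M ω = n + 1} := fun n =>
    h.measurable_M (measurableSet_singleton _)
  have hU : {ω | 1 ≤ M ω} = ⋃ n, {ω | M ω = n + 1} := by
    ext ω
    simp only [Set.mem_ofPred_eq, Set.mem_iUnion]
    exact ⟨fun hω => Nat.exists_eq_add_of_le' hω, fun ⟨n, hn⟩ => by omega⟩
  have hP : P {ω | 1 ≤ M ω} = 1 := by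
    rw [hU, measure_iUnion (fun i j hij => Set.disjoint_left.2 fun ω hi hj => hij (by
      simp only [Set.mem_ofPred_eq] at hi hj; omega)) hmeas]
    have := ENNReal.ofReal_tsum_of_nonneg (fun n => measureReal_nonneg) hs.summable
    rw [hs.tsum_eq, ENNReal.ofReal_one] at this
    rw [this]
    exact tsum_congr fun n => (ofReal_measureReal).symm
  exact (mem_ae_iff_prob_eq_one (measurableSet_le measurable_const h.measurable_M)).2 hP

/-- The random sum, evaluated at Lipschitz test functions, has the equilibrium variable
`S (M - 1) + Xe M`. -/
lemma hasSum_equilibrium {f : ℝ → ℝ} {L : NNReal} (hf : LipschitzWith L f) :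
    HasSum (fun n => P.real {ω | M ω = n + 1} *
        ∫ ω, deriv f (partialSum X n ω + Xe (n + 1) ω) ∂P)
      (μ⁻¹ * (∫ ω, f (partialSum X (N ω) ω) ∂P - f 0)) := by
  refine (hasSum_congr fun n => ?_).2 ((h.hasSum_prob_mul_integral_sub hf).mul_left μ⁻¹)
  rw [h.integral_lipschitz_sub hf, ← mul_assoc (P.real _), mul_comm (P.real _) (m _), h.mean_mul_prob, mul_assoc,
    inv_mul_cancel_left₀ h.pos.ne']

end IsModel

/-- At the kink `deriv` takes its default value `0`, hence the open half-line, and strict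
inequalities in the events below. -/
lemma deriv_min_const (t x : ℝ) :
    deriv (fun y => min y t) x = (Set.Iio t).indicator (fun _ => 1) x := by
  rcases lt_trichotomy x t with hx | rfl | hx
  · rw [Set.indicator_of_mem (by exact hx)]
    have : (fun y => min y t) =ᶠ[𝓝 x] id := by
      filter_upwards [eventually_lt_nhds hx] with y hy using min_eq_left hy.le
    rw [this.deriv_eq, deriv_id]
  · rw [Set.indicator_of_notMem (by simp)]
    refine deriv_zero_of_not_differentiableAt fun hd => ?_
    have h1 : HasDerivWithinAt (fun y => min y x) 1 (Set.Iic x) x :=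
      (hasDerivWithinAt_id x _).congr (fun y hy => min_eq_left hy) (min_self x)
    have h2 : HasDerivWithinAt (fun y => min y x) 0 (Set.Ici x) x :=
      (hasDerivWithinAt_const x _ x).congr (fun y hy => min_eq_right hy) (min_self x)
    have h3 := (uniqueDiffWithinAt_Iic x).eq_deriv _ h1 hd.hasDerivAt.hasDerivWithinAt
    have h4 := (uniqueDiffWithinAt_Ici x).eq_deriv _ h2 hd.hasDerivAt.hasDerivWithinAt
    rw [← h4] at h3
    exact one_ne_zero h3
  · rw [Set.indicator_of_notMem (by simpa using hx.le)]
    have : (fun y => min y t) =ᶠ[𝓝 x] fun _ => t := by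
      filter_upwards [eventually_gt_nhds hx] with y hy using min_eq_right hy.le
    rw [this.deriv_eq, deriv_const]

/-! ### The Kolmogorov and Wasserstein bounds for the random sum -/

namespace IsModel

variable [MeasurableSpace Ω] {P : Measure Ω} [IsProbabilityMeasure P]
  {X : ℕ → Ω → ℝ} {m : ℕ → ℝ} {N M : Ω → ℕ} {μ : ℝ} {Xe : ℕ → Ω → ℝ}
  (h : IsModel P X m N M μ Xe)

include h

lemma measurable_partialSum_N : Measurable fun ω => partialSum X (N ω) ω :=
  measurable_eval_nat (measurable_partialSum h.measurable_X) h.measurable_N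

lemma measurable_partialSum_M : Measurable fun ω => partialSum X (M ω) ω :=
  measurable_eval_nat (measurable_partialSum h.measurable_X) h.measurable_M

lemma hasSum_measure_partialSum_M (t : ℝ) :
    HasSum (fun n => P.real {ω | M ω = n + 1} * P.real {ω | partialSum X (n + 1) ω < t})
      (P.real {ω | partialSum X (M ω) ω < t}) := by
  have hφ : Measurable ((Set.Iio t).indicator fun _ => (1 : ℝ)) :=
    measurable_const.indicator measurableSet_Iio
  have hm := measurable_partialSum h.measurable_X
  have hI : ∀ Y : Ω → ℝ, Measurable Y →
      ∫ ω, (Set.Iio t).indicator (fun _ => (1 : ℝ)) (Y ω) ∂P = P.real {ω | Y ω < t} := by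
    intro Y hY
    rw [← integral_indicator_one (measurableSet_lt hY measurable_const)]
    rfl
  have key := hasSum_integral_eval_nat (P := P)
    (T := fun k ω => (Set.Iio t).indicator (fun _ => (1 : ℝ)) (partialSum X k ω))
    (fun k _ => hφ.comp (hm k)) (B := 1)
    (fun k _ ω => by simp only [Set.indicator_apply]; split_ifs <;> simp)
    h.measurable_M h.one_le_M (fun k hk => by
      obtain ⟨n, rfl⟩ := Nat.exists_eq_add_of_le' hk
      simp only [partialSum_succ]
      exact (h.indep_summand (φ := fun p => (Set.Iio t).indicator (fun _ => (1 : ℝ))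
        (p.1 + p.2.1)) (hφ.comp (by fun_prop)) n).2)
  rw [hI _ h.measurable_partialSum_M] at key
  refine (hasSum_congr fun n => ?_).2 key
  rw [hI _ (hm _)]

/-- The equilibrium identity for the test function `min x t`: both sides are `P(S (M-1) + Xe M <
t)`, expanded over the values of `M`. -/
lemma hasSum_measure_equilibrium {t : ℝ} (ht : 0 ≤ t) :
    HasSum (fun n => P.real {ω | M ω = n + 1} *
        P.real {ω | partialSum X n ω + Xe (n + 1) ω < t})
      (μ⁻¹ * ∫ ω, min (partialSum X (N ω) ω) t ∂P) := by
  have key := h.hasSum_equilibrium (LipschitzWith.id.min_const t)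
  simp only [id, min_eq_left ht, sub_zero, deriv_min_const] at key
  refine (hasSum_congr fun n => ?_).2 key
  have hset : MeasurableSet {ω | partialSum X n ω + Xe (n + 1) ω < t} :=
    measurableSet_lt ((measurable_partialSum h.measurable_X n).add
      (h.measurable_Xe (n + 1) (by simp))) measurable_const
  rw [← integral_indicator_one hset]
  rfl

/-- The random sum up to `M` and the equilibrium distribution are within `δ` of each other. -/
lemma measure_partialSum_M_le {δ : ℝ} (hδ : 0 ≤ δ)
    (hq : ∀ i ≥ 1, ∀ᵐ ω ∂P,
      quantileDist (condLaw P X i (X i) ω) (condLaw P X i (Xe i) ω) ≤ ENNReal.ofReal δ)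
    {t : ℝ} (ht : 0 ≤ t) :
    P.real {ω | partialSum X (M ω) ω < t - δ} ≤ μ⁻¹ * ∫ ω, min (partialSum X (N ω) ω) t ∂P ∧
    μ⁻¹ * ∫ ω, min (partialSum X (N ω) ω) t ∂P ≤ P.real {ω | partialSum X (M ω) ω < t + δ} := by
  have hs : ∀ n : ℕ, Measurable fun v : Finset.Ico 1 (n + 1) → ℝ => ∑ j, v j := fun n => by
    fun_prop
  constructor
  · refine hasSum_le (fun n => ?_) (h.hasSum_measure_partialSum_M (t - δ))
      (h.hasSum_measure_equilibrium ht)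
    refine mul_le_mul_of_nonneg_left ?_ measureReal_nonneg
    have := measure_lt_le_of_quantileDist_le h.measurable_X (n + 1)
      (h.measurable_X (n + 1) (by simp)) (h.measurable_Xe (n + 1) (by simp)) (hs n) hδ
      (hq (n + 1) (by simp)) (t - δ)
    simpa only [sum_past, sub_add_cancel, ← partialSum_succ] using this
  · refine hasSum_le (fun n => ?_) (h.hasSum_measure_equilibrium ht)
      (h.hasSum_measure_partialSum_M (t + δ))
    refine mul_le_mul_of_nonneg_left ?_ measureReal_nonneg
    have := measure_lt_le_of_quantileDist_le h.measurable_X (n + 1)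
      (h.measurable_Xe (n + 1) (by simp)) (h.measurable_X (n + 1) (by simp)) (hs n) hδ
      (by
        filter_upwards [hq (n + 1) (by simp)] with ω hω
        rwa [quantileDist_comm]) t
    simpa only [sum_past, ← partialSum_succ] using this

lemma measurable_scaled : Measurable fun ω => μ⁻¹ * partialSum X (N ω) ω :=
  h.measurable_partialSum_N.const_mul _

/-- Replacing `S M` by `S N` costs a further shift `D`; after scaling the total shift is `β = μ⁻¹ (δ
+ D)`. -/
lemma dK_le {δ D : ℝ} (hδ : 0 ≤ δ) (hD : 0 ≤ D)
    (hq : ∀ i ≥ 1, ∀ᵐ ω ∂P,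
      quantileDist (condLaw P X i (X i) ω) (condLaw P X i (Xe i) ω) ≤ ENNReal.ofReal δ)
    (hMN : ∀ᵐ ω ∂P, |partialSum X (M ω) ω - partialSum X (N ω) ω| ≤ D) :
    dK (P.map fun ω => μ⁻¹ * partialSum X (N ω) ω) (expMeasure 1) ≤
      ENNReal.ofReal (2 * (μ⁻¹ * (δ + D))) := by
  have hμ := h.pos
  have hW := h.measurable_scaled
  have hprob : IsProbabilityMeasure (P.map fun ω => μ⁻¹ * partialSum X (N ω) ω) :=
    Measure.isProbabilityMeasure_map hW.aemeasurable
  have hIio : ∀ z, (P.map fun ω => μ⁻¹ * partialSum X (N ω) ω).real (Set.Iio z) =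
      P.real {ω | partialSum X (N ω) ω < μ * z} := fun z => by
    rw [map_measureReal_apply hW measurableSet_Iio]
    congr 1
    ext ω
    simp [inv_mul_lt_iff₀ hμ]
  have hmin : ∀ z, ∫ x, min x z ∂(P.map fun ω => μ⁻¹ * partialSum X (N ω) ω) =
      μ⁻¹ * ∫ ω, min (partialSum X (N ω) ω) (μ * z) ∂P := fun z => by
    rw [integral_map hW.aemeasurable (by fun_prop), ← integral_const_mul]
    congr 1
    ext ω
    rw [mul_min_of_nonneg _ _ (inv_nonneg.2 hμ.le), inv_mul_cancel_left₀ hμ.ne']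
  have hscale : μ * (μ⁻¹ * (δ + D)) = δ + D := mul_inv_cancel_left₀ hμ.ne' _
  refine dK_expMeasure_le ?_ (by positivity) (fun z hz => ?_) (fun z hz => ?_)
  · rw [ae_map_iff hW.aemeasurable measurableSet_Ici]
    filter_upwards [h.ae_nonneg] with ω hω
    exact mul_nonneg (inv_nonneg.2 hμ.le) (Finset.sum_nonneg fun j _ => hω j)
  · rw [hIio, hmin, mul_sub, hscale]
    refine le_trans ?_ (h.measure_partialSum_M_le hδ hq (mul_nonneg hμ.le hz)).1
    refine ENNReal.toReal_mono (measure_ne_top _ _) (measure_mono_ae ?_)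
    filter_upwards [hMN] with ω hω (hlt : _ < _)
    have := (abs_le.1 hω).2
    exact show _ < _ by linarith
  · rw [hIio, hmin, mul_add, hscale]
    refine (h.measure_partialSum_M_le hδ hq (mul_nonneg hμ.le hz)).2.trans ?_
    refine ENNReal.toReal_mono (measure_ne_top _ _) (measure_mono_ae ?_)
    filter_upwards [hMN] with ω hω (hlt : _ < _)
    have := (abs_le.1 hω).1
    exact show _ < _ by linarith

lemma dK_le_supQuantileDist {D : ℝ} (hD : 0 ≤ D)
    (hMN : ∀ᵐ ω ∂P, |partialSum X (M ω) ω - partialSum X (N ω) ω| ≤ D) :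
    dK (P.map fun ω => μ⁻¹ * partialSum X (N ω) ω) (expMeasure 1) ≤
      ENNReal.ofReal (12 * μ⁻¹) * (supQuantileDist P X Xe + ENNReal.ofReal D) := by
  have hμ := h.pos
  by_cases htop : supQuantileDist P X Xe = ⊤
  · have h12 : 0 < 12 * μ⁻¹ := by positivity
    rw [htop, top_add, ENNReal.mul_top (by simpa using h12)]
    exact le_top
  have hδ := ENNReal.ofReal_toReal htop
  set δ := (supQuantileDist P X Xe).toReal
  have hδ0 : 0 ≤ δ := ENNReal.toReal_nonneg
  have hq : ∀ i ≥ 1, ∀ᵐ ω ∂P,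
      quantileDist (condLaw P X i (X i) ω) (condLaw P X i (Xe i) ω) ≤ ENNReal.ofReal δ := by
    intro i hi
    rw [hδ]
    filter_upwards [ENNReal.ae_le_essSup
      fun ω => quantileDist (condLaw P X i (X i) ω) (condLaw P X i (Xe i) ω)] with ω hω
    exact hω.trans (le_iSup₂_of_le i hi le_rfl)
  refine (h.dK_le hδ0 hD hq hMN).trans ?_
  rw [← hδ, ← ENNReal.ofReal_add hδ0 hD, ← ENNReal.ofReal_mul (by positivity)]
  refine ENNReal.ofReal_le_ofReal ?_
  -- The argument yields the constant `2`; it is simply relaxed to `12`.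
  have : 0 ≤ μ⁻¹ * (δ + D) := by positivity
  linarith

/-- With summands bounded by `C`, partial sums are `C`-Lipschitz in the number of summands. -/
lemma ae_abs_partialSum_sub_le {C : ℝ} (hC : ∀ i ≥ 1, ∀ᵐ ω ∂P, X i ω ≤ C) :
    ∀ᵐ ω ∂P, ∀ a b : ℕ, |partialSum X a ω - partialSum X b ω| ≤ C * |(b : ℝ) - a| := by
  have hC' : ∀ᵐ ω ∂P, ∀ n, X (n + 1) ω ≤ C := ae_all_iff.2 fun n => hC _ (by simp)
  filter_upwards [h.ae_nonneg, hC'] with ω h0 h1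
  intro a b
  wlog hab : a ≤ b generalizing a b
  · rw [abs_sub_comm, abs_sub_comm (b : ℝ)]
    exact this b a (le_of_not_ge hab)
  have hab' : (0 : ℝ) ≤ b - a := sub_nonneg.2 (Nat.cast_le.2 hab)
  have e : partialSum X b ω - partialSum X a ω = ∑ j ∈ Finset.Ico a b, X (j + 1) ω :=
    (Finset.sum_Ico_eq_sub _ hab).symm
  rw [abs_sub_comm, e, abs_of_nonneg (Finset.sum_nonneg fun j _ => h0 j), abs_of_nonneg hab']
  refine (Finset.sum_le_card_nsmul _ _ C fun j _ => h1 j).trans_eq ?_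
  rw [Nat.card_Ico, nsmul_eq_mul, Nat.cast_sub hab, mul_comm]

/-- `S N - S M` is, up to sign, a sum of `X (n+1)` over the indices `n` between `N` and `M`. The
event that `n` is such an index depends on the pair `(N, M)`, so it is independent of `X (n+1)`; the
probabilities of these events add up to `E|N - M|`. -/
lemma lintegral_abs_partialSum_sub_le :
    ∫⁻ ω, ENNReal.ofReal |partialSum X (N ω) ω - partialSum X (M ω) ω| ∂P ≤
      (⨆ i ≥ 1, ENNReal.ofReal (m i)) *
        ∫⁻ ω, ENNReal.ofReal |(N ω : ℝ) - (M ω : ℝ)| ∂P := by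
  set s : Ω → Finset ℕ := fun ω => Finset.Ico (min (N ω) (M ω)) (max (N ω) (M ω))
  have hmem : ∀ n ω, n ∈ s ω ↔ min (N ω) (M ω) ≤ n ∧ n < max (N ω) (M ω) := fun n ω =>
    Finset.mem_Ico
  have hmin := h.measurable_N.min h.measurable_M
  have hmax := h.measurable_N.max h.measurable_M
  have hset : ∀ n, MeasurableSet {ω | n ∈ s ω} := fun n => by
    simp only [hmem]
    exact (measurableSet_le hmin measurable_const).inter (measurableSet_lt measurable_const hmax)
  have htsum : ∀ ω (c : ℕ → ℝ≥0∞),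
      ∑' n, {ω | n ∈ s ω}.indicator (fun _ => c n) ω = ∑ n ∈ s ω, c n := by
    intro ω c
    have h0 : ∀ n ∉ s ω, {ω | n ∈ s ω}.indicator (fun _ => c n) ω = 0 := fun n hn =>
      Set.indicator_of_notMem (by exact hn) _
    rw [tsum_eq_sum h0]
    exact Finset.sum_congr rfl fun n hn => Set.indicator_of_mem (by exact hn) _
  have hcard : ∀ ω, ENNReal.ofReal |(N ω : ℝ) - (M ω : ℝ)| = ∑ n ∈ s ω, 1 := by
    intro ω
    rw [Finset.sum_const, Nat.card_Ico, nsmul_one]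
    rcases le_total (N ω) (M ω) with hle | hle
    · rw [min_eq_left hle, max_eq_right hle, abs_sub_comm, ← Nat.cast_sub hle, Nat.abs_cast,
        ENNReal.ofReal_natCast]
    · rw [min_eq_right hle, max_eq_left hle, ← Nat.cast_sub hle, Nat.abs_cast,
        ENNReal.ofReal_natCast]
  have hle : ∀ ω, ENNReal.ofReal |partialSum X (N ω) ω - partialSum X (M ω) ω| ≤
      ∑ n ∈ s ω, ENNReal.ofReal |X (n + 1) ω| := by
    intro ω
    rw [← ENNReal.ofReal_sum_of_nonneg fun n _ => abs_nonneg _]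
    refine ENNReal.ofReal_le_ofReal ?_
    refine le_trans (le_of_eq ?_) (Finset.abs_sum_le_sum_abs _ _)
    rw [Finset.sum_Ico_eq_sub _ min_le_max]
    rcases le_total (N ω) (M ω) with hle | hle
    · rw [min_eq_left hle, max_eq_right hle, abs_sub_comm]; rfl
    · rw [min_eq_right hle, max_eq_left hle]; rfl
  have hterm : ∀ n, ∫⁻ ω, {ω | n ∈ s ω}.indicator (fun _ => ENNReal.ofReal |X (n + 1) ω|) ω ∂P ≤
      (⨆ i ≥ 1, ENNReal.ofReal (m i)) * P {ω | n ∈ s ω} := by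
    intro n
    have hind : IndepFun (fun ω => ENNReal.ofReal |X (n + 1) ω|)
        ({ω | n ∈ s ω}.indicator fun _ => (1 : ℝ≥0∞)) P :=
      (h.indep (n + 1) (by simp)).comp
        (φ := fun p : (Set.Ici (1 : ℕ) → ℝ) × ℝ => ENNReal.ofReal |p.1 ⟨n + 1, by simp⟩|)
        (ψ := {q : ℕ × ℕ | n ∈ Finset.Ico (min q.1 q.2) (max q.1 q.2)}.indicator
          fun _ => (1 : ℝ≥0∞)) (by fun_prop) (measurable_of_countable _)
    have hXm := h.measurable_X (n + 1) (by simp)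
    have key := lintegral_mul_eq_lintegral_mul_lintegral_of_indepFun (μ := P)
      (f := fun ω => ENNReal.ofReal |X (n + 1) ω|) (by fun_prop)
      (measurable_const.indicator (hset n)) hind
    have e1 : ∫⁻ ω, ENNReal.ofReal |X (n + 1) ω| ∂P = ENNReal.ofReal (m (n + 1)) := by
      rw [← h.integral_X (i := n + 1) (by simp), ofReal_integral_eq_lintegral_ofReal
        (h.integrable_X _ (by simp)) (h.nonneg _ (by simp))]
      refine lintegral_congr_ae ?_
      filter_upwards [h.nonneg (n + 1) (by simp)] with ω hω
      rw [abs_of_nonneg hω]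
    have e2 : ∫⁻ ω, {ω | n ∈ s ω}.indicator (fun _ => (1 : ℝ≥0∞)) ω ∂P = P {ω | n ∈ s ω} :=
      lintegral_indicator_one (hset n)
    rw [e1, e2] at key
    calc _ = _ := lintegral_congr fun ω => by simp [Set.indicator_apply]
      _ = _ := key
      _ ≤ _ := by
          gcongr
          exact le_iSup₂_of_le (f := fun i (_ : i ≥ 1) => ENNReal.ofReal (m i)) (n + 1)
            (Nat.le_add_left 1 n) le_rfl
  have hXe : ∀ n, Measurable fun ω => ENNReal.ofReal |X (n + 1) ω| := fun n => by
    have := h.measurable_X (n + 1) (by simp)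
    fun_prop
  calc _ ≤ ∫⁻ ω, ∑' n, {ω | n ∈ s ω}.indicator (fun _ => ENNReal.ofReal |X (n + 1) ω|) ω ∂P :=
        lintegral_mono fun ω => (hle ω).trans_eq (htsum ω _).symm
    _ = ∑' n, ∫⁻ ω, {ω | n ∈ s ω}.indicator (fun _ => ENNReal.ofReal |X (n + 1) ω|) ω ∂P :=
        lintegral_tsum fun n => ((hXe n).indicator (hset n)).aemeasurable
    _ ≤ ∑' n, (⨆ i ≥ 1, ENNReal.ofReal (m i)) * P {ω | n ∈ s ω} := ENNReal.tsum_le_tsum hterm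
    _ = (⨆ i ≥ 1, ENNReal.ofReal (m i)) * ∑' n, P {ω | n ∈ s ω} := ENNReal.tsum_mul_left
    _ = (⨆ i ≥ 1, ENNReal.ofReal (m i)) *
          ∑' n, ∫⁻ ω, {ω | n ∈ s ω}.indicator (fun _ => 1) ω ∂P := by
        congr 1
        exact tsum_congr fun n => (lintegral_indicator_one (hset n)).symm
    _ = _ := by
        rw [← lintegral_tsum fun n => (measurable_const.indicator (hset n)).aemeasurable]
        congr 1
        exact lintegral_congr fun ω => by rw [htsum, hcard]

lemma dW_le : dW (P.map fun ω => μ⁻¹ * partialSum X (N ω) ω) (expMeasure 1) ≤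
    ENNReal.ofReal (2 * μ⁻¹) * ((∫⁻ ω, ENNReal.ofReal |X (M ω) ω - Xe (M ω) ω| ∂P) +
      (⨆ i ≥ 1, ENNReal.ofReal (m i)) *
        ∫⁻ ω, ENNReal.ofReal |(N ω : ℝ) - (M ω : ℝ)| ∂P) := by
  have hμ := h.pos
  refine iSup₂_le fun φ hφ => ?_
  replace hφ : LipschitzWith 1 φ := hφ
  obtain ⟨f, hf0, hf, hderiv⟩ := exists_stein_solution hφ
  set c := ∫ t, φ t ∂(expMeasure 1)
  set g : ℝ → ℝ := fun x => f x + φ x - c with hg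
  have hgL : ∀ x y, |g x - g y| ≤ 2 * |x - y| := by
    intro x y
    have h1 := hf.dist_le_mul x y
    have h2 := hφ.dist_le_mul x y
    rw [Real.dist_eq, Real.dist_eq] at h1 h2
    have h3 := abs_add_le (f x - f y) (φ x - φ y)
    rw [show g x - g y = (f x - f y) + (φ x - φ y) by simp only [hg]; ring]
    simp at h1 h2
    linarith
  have hgm : Measurable g :=
    (hf.continuous.measurable.add hφ.continuous.measurable).sub_const c
  -- `g` is the derivative of the 1-Lipschitz `f`; boundedness removes any need for moments of `Xe`.
  have hgB : ∀ x, |g x| ≤ 1 := fun x => by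
    have := norm_deriv_le_of_lipschitz (x₀ := x) hf
    rwa [(hderiv x).deriv] at this
  have hSm := measurable_partialSum h.measurable_X
  set T : ℕ → Ω → ℝ := fun k ω => partialSum X (k - 1) ω + Xe k ω with hT
  have hTm : ∀ k ≥ 1, Measurable (T k) := fun k hk => (hSm _).add (h.measurable_Xe k hk)
  have hfscale : LipschitzWith (1 * ⟨μ⁻¹, by positivity⟩) fun x => f (μ⁻¹ * x) := by
    refine hf.comp (LipschitzWith.of_dist_le_mul fun x y => ?_)
    rw [Real.dist_eq, Real.dist_eq, ← mul_sub, abs_mul, abs_of_pos (inv_pos.2 hμ)]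
    rfl
  have hdscale : ∀ x, deriv (fun x => f (μ⁻¹ * x)) x = μ⁻¹ * g (μ⁻¹ * x) := fun x => by
    rw [deriv_comp_mul_left, (hderiv _).deriv, smul_eq_mul]
  have key1 := h.hasSum_equilibrium hfscale
  have key2 := (hasSum_integral_eval_nat (P := P) (T := fun k ω => g (μ⁻¹ * T k ω))
    (fun k hk => hgm.comp ((hTm k hk).const_mul _)) (B := 1) (fun k _ ω => hgB _)
    h.measurable_M h.one_le_M (fun k hk => by
      obtain ⟨n, rfl⟩ := Nat.exists_eq_add_of_le' hk
      exact (h.indep_summand (φ := fun p => g (μ⁻¹ * (p.1 + p.2.2)))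
        (hgm.comp (by fun_prop)) n).2)).mul_left μ⁻¹
  -- `E f(W) = E f'(We)`: both are sums of the same series over the values of `M`. The factor `μ⁻¹`
  -- from differentiating the rescaled `f` cancels.
  have heq : ∫ ω, f (μ⁻¹ * partialSum X (N ω) ω) ∂P = ∫ ω, g (μ⁻¹ * T (M ω) ω) ∂P := by
    have := key1.unique ((hasSum_congr fun n => ?_).2 key2)
    · rw [mul_zero, hf0, sub_zero] at this
      exact mul_left_cancel₀ (inv_ne_zero hμ.ne') this
    · simp only [hdscale, integral_const_mul, hT, Nat.add_sub_cancel]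
      ring
  have hTM : AEMeasurable (fun ω => T (M ω) ω) P :=
    aemeasurable_eval_nat hTm h.measurable_M h.one_le_M
  have hW := h.measurable_scaled
  have hint1 : Integrable (fun ω => g (μ⁻¹ * partialSum X (N ω) ω)) P :=
    (integrable_const (1 : ℝ)).mono' (hgm.comp hW).aestronglyMeasurable
      (ae_of_all _ fun ω => hgB _)
  have hint2 : Integrable (fun ω => g (μ⁻¹ * T (M ω) ω)) P :=
    (integrable_const (1 : ℝ)).mono' (hgm.comp_aemeasurable (hTM.const_mul _)).aestronglyMeasurable
      (ae_of_all _ fun ω => hgB _)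
  have hintf := h.integrable_lipschitz hfscale
  have hdiff : ∫ x, φ x ∂(P.map fun ω => μ⁻¹ * partialSum X (N ω) ω) - c =
      ∫ ω, (g (μ⁻¹ * partialSum X (N ω) ω) - g (μ⁻¹ * T (M ω) ω)) ∂P := by
    rw [integral_map hW.aemeasurable hφ.continuous.aestronglyMeasurable,
      integral_sub hint1 hint2, ← heq, ← integral_sub hint1 hintf]
    have e : ∀ ω, φ (μ⁻¹ * partialSum X (N ω) ω) =
        (g (μ⁻¹ * partialSum X (N ω) ω) - f (μ⁻¹ * partialSum X (N ω) ω)) + c := fun ω => by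
      simp only [hg]; ring
    have e2 := integral_add (hint1.sub hintf) (integrable_const c)
    simp only [Pi.sub_apply, integral_const, probReal_univ, one_smul] at e2
    simp only [e]
    rw [e2, add_sub_cancel_right]
  have hbound : ∀ᵐ ω ∂P, ‖g (μ⁻¹ * partialSum X (N ω) ω) - g (μ⁻¹ * T (M ω) ω)‖ₑ ≤
      ENNReal.ofReal (2 * μ⁻¹) * (ENNReal.ofReal |X (M ω) ω - Xe (M ω) ω| +
        ENNReal.ofReal |partialSum X (N ω) ω - partialSum X (M ω) ω|) := by
    filter_upwards [h.one_le_M] with ω hω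
    rw [← ENNReal.ofReal_add (abs_nonneg _) (abs_nonneg _), ← ENNReal.ofReal_mul (by positivity),
      ← ofReal_norm, Real.norm_eq_abs]
    refine ENNReal.ofReal_le_ofReal ((hgL _ _).trans ?_)
    rw [← mul_sub, abs_mul, abs_of_pos (inv_pos.2 hμ), mul_assoc]
    refine mul_le_mul_of_nonneg_left (mul_le_mul_of_nonneg_left ?_ (by positivity)) (by norm_num)
    have e : partialSum X (M ω) ω = partialSum X (M ω - 1) ω + X (M ω) ω := by
      conv_lhs => rw [← Nat.sub_add_cancel hω, partialSum_succ, Nat.sub_add_cancel hω]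
    have := abs_add_le (X (M ω) ω - Xe (M ω) ω) (partialSum X (N ω) ω - partialSum X (M ω) ω)
    refine le_trans (le_of_eq ?_) this
    congr 1
    rw [e]
    simp only [hT]
    ring
  have hXM : AEMeasurable (fun ω => X (M ω) ω - Xe (M ω) ω) P :=
    (aemeasurable_eval_nat h.measurable_X h.measurable_M h.one_le_M).sub
      (aemeasurable_eval_nat h.measurable_Xe h.measurable_M h.one_le_M)
  rw [hdiff, ← Real.norm_eq_abs, ofReal_norm]
  refine (enorm_integral_le_lintegral_enorm _).trans ((lintegral_mono_ae hbound).trans ?_)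
  rw [lintegral_const_mul' _ _ ENNReal.ofReal_ne_top,
    lintegral_add_left' (by fun_prop)]
  gcongr
  exact h.lintegral_abs_partialSum_sub_le

end IsModel

end RandomSum

theorem theorem3 {Ω : Type*} [MeasurableSpace Ω] (P : Measure Ω) [IsProbabilityMeasure P]
    -- the summands `X 1, X 2, ...`
    (X : ℕ → Ω → ℝ)
    (hX_meas : ∀ i ≥ 1, Measurable (X i))
    (hX_sq : ∀ i ≥ 1, MemLp (X i) 2 P)
    (hX_nonneg : ∀ i ≥ 1, ∀ᵐ ω ∂P, 0 ≤ X i ω)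
    (m : ℕ → ℝ)
    (hX_mean : ∀ i ≥ 1,
      P[X i | MeasurableSpace.comap (RandomSum.past X i) inferInstance] =ᵐ[P] fun _ => m i)
    -- the number of summands
    (N : Ω → ℕ) (hN_meas : Measurable N) (hN_pos : ∀ᵐ ω ∂P, 1 ≤ N ω)
    (hN_int : Integrable (fun ω => (N ω : ℝ)) P)
    -- the mean `μ` of the random sum, `0 < μ < ∞`
    (μ : ℝ) (hμ_int : Integrable (RandomSum.randomSum X N) P)
    (hμ : μ = ∫ ω, RandomSum.randomSum X N ω ∂P) (hμ_pos : 0 < μ)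
    -- the random index `M`
    (M : Ω → ℕ) (hM_meas : Measurable M)
    (hM : ∀ k ≥ 1, P.real {ω | M ω = k} = m k * P.real {ω | k ≤ N ω} / μ)
    -- `Xe i` has the equilibrium distribution w.r.t. `X i`, given `X 1, ..., X (i - 1)`
    (Xe : ℕ → Ω → ℝ)
    (hXe_meas : ∀ i ≥ 1, Measurable (Xe i))
    (hXe : ∀ i ≥ 1, ∀ᵐ ω ∂P, RandomSum.IsEquilibrium
      (RandomSum.condLaw P X i (X i) ω) (RandomSum.condLaw P X i (Xe i) ω))
    -- `(X, Xe i)` is independent of `(N, M)`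
    (hindep : ∀ i ≥ 1, IndepFun
      (fun ω => ((fun j : Set.Ici (1 : ℕ) => X j ω), Xe i ω)) (fun ω => (N ω, M ω)) P) :
    -- the two expressions for `μ` agree
    HasSum (fun k : ℕ => m (k + 1) * P.real {ω | k + 1 ≤ N ω}) μ ∧
    -- the Wasserstein bound
    RandomSum.dW (P.map (fun ω => μ⁻¹ * RandomSum.randomSum X N ω)) (expMeasure 1) ≤
      ENNReal.ofReal (2 * μ⁻¹) *
        ((∫⁻ ω, ENNReal.ofReal |X (M ω) ω - Xe (M ω) ω| ∂P) +
          (⨆ i ≥ 1, ENNReal.ofReal (m i)) *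
            ∫⁻ ω, ENNReal.ofReal |(N ω : ℝ) - (M ω : ℝ)| ∂P) ∧
    -- the Kolmogorov bound, bounded case
    (∀ C K : ℝ, (∀ i ≥ 1, ∀ᵐ ω ∂P, X i ω ≤ C) →
      (∀ᵐ ω ∂P, |(N ω : ℝ) - (M ω : ℝ)| ≤ K) →
      RandomSum.dK (P.map (fun ω => μ⁻¹ * RandomSum.randomSum X N ω)) (expMeasure 1) ≤
        ENNReal.ofReal (12 * μ⁻¹) *
          (RandomSum.supQuantileDist P X Xe + ENNReal.ofReal (C * K))) ∧
    -- the Kolmogorov bound with `K = 0`, without boundedness of the `X i`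
    ((∀ᵐ ω ∂P, N ω = M ω) →
      RandomSum.dK (P.map (fun ω => μ⁻¹ * RandomSum.randomSum X N ω)) (expMeasure 1) ≤
        ENNReal.ofReal (12 * μ⁻¹) * RandomSum.supQuantileDist P X Xe) := by
  have h : RandomSum.IsModel P X m N M μ Xe :=
    { measurable_X := hX_meas
      integrable_X := fun i hi => (hX_sq i hi).integrable one_le_two
      nonneg := hX_nonneg
      mean := hX_mean
      measurable_N := hN_meas
      integrable_sum := by rwa [RandomSum.randomSum_eq_partialSum] at hμ_int
      integral_sum := by rw [hμ, RandomSum.randomSum_eq_partialSum]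
      pos := hμ_pos
      measurable_M := hM_meas
      law_M := hM
      measurable_Xe := hXe_meas
      equilibrium := hXe
      indep := hindep }
  simp only [RandomSum.randomSum_eq_partialSum]
  refine ⟨h.hasSum_mean, h.dW_le, fun C K hC hK => ?_, fun hNM => ?_⟩
  · have hC0 : 0 ≤ C := by
      obtain ⟨ω, h0, h1⟩ := ((hX_nonneg 1 le_rfl).and (hC 1 le_rfl)).exists
      exact h0.trans h1
    have hK0 : 0 ≤ K := by
      obtain ⟨ω, h0⟩ := hK.exists
      exact (abs_nonneg _).trans h0
    refine h.dK_le_supQuantileDist (mul_nonneg hC0 hK0) ?_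
    filter_upwards [h.ae_abs_partialSum_sub_le hC, hK] with ω h1 h2
    exact (h1 (M ω) (N ω)).trans (mul_le_mul_of_nonneg_left h2 hC0)
  · have := h.dK_le_supQuantileDist le_rfl (by
      filter_upwards [hNM] with ω hω
      simp [hω])
    simpa using this
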